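/- **Definitions.** A *partial semigroup* is a set $S$ with a partially defined binary operation such that $(xy)z=x(yz)$, meaning that one side is defined if and only if the other is, and then they are equal. A subset $A\subseteq S$ closed under defined products is a partial semigroup with the inherited operation; for $F\subseteq A$ let $\varphi_A(F)$ be the set of $y\in A$ such that $xy$ is defined for all $x\in F$. $A$ is *adequate* if it is closed under defined products and $\varphi_A(F)\neq\emptyset$ for every finite $F\subseteq A$. A map $\sigma:A\to B$ is a *homomorphism* if, whenever $xy$ is defined, $\sigma(x)\sigma(y)$ is defined and equals $\sigma(xy)$; it is an *adequate homomorphism* if moreover for every finite $F\subseteq B$ there is a finite $H\subseteq A$ with $\sigma[\varphi_A(H)]\subseteq\varphi_B(F)$. $A\subseteq B$ is an *adequate partial subsemigroup* of $B$ if $A$ is adequate and the inclusion $A\to B$ is an adequate homomorphism; it is an *adequate ideal* of $B$ if moreover $xy$ and $yx$ belong to $A$ whenever $x\in A$, $y\in B$ and they are defined. A *layered partial semigroup with $k$ layers* is a partial semigroup $S$ with a partition $S_0,\dots,S_k$ such that $S_0=\{e\}$ for an identity element $e$ of $S$ (that is, $ex$ and $xe$ are defined and equal to $x$ for all $x$)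 and, for $1\le n\le k$, with $S_{\le n}=S_0\cup\dots\cup S_n$: $S_{\le n}$ is adequate, $S_n$ is an adequate partial subsemigroup of $S$, and $S_n$ is an adequate ideal of $S_{\le n}$. A *tetris action* on $S$ consists, for $1\le n\le k$, of a nonempty finite set $\mathcal F_n$ of homomorphisms $S_{\le n}\to S_{\le n-1}$ and an adequate partial subsemigroup $M_n$ of $S_n$ such that for all $2\le n\le k$ and $\sigma\in\mathcal F_n$: (1) $\sigma[M_n]$ is an adequate partial subsemigroup of $M_{n-1}$; (2) $\sigma[S_n]$ is an adequate partial subsemigroup of $S_{n-1}$; (3) $\sigma|_{S_{\le n-1}}$ belongs to $\mathcal F_{n-1}$ or is the identity map; (4) $\sigma|_{M_n}=\sigma'|_{M_n}$ for every $\sigma'\in\mathcal F_n$. For $0\le n\le j\le k$ let $\mathcal G^{j}_n$ be the set of maps $S_j\to S_n$ of the form $\sigma_{n+1}\circ\sigma_{n+2}\circ\cdots\circ\sigma_j$ with $\sigma_i\in\mathcal F_i$ (the identity map if $n=j$). A finite or infinite sequence $(b_i)$ in $S_j$ is a *block sequence in $S_j$* if $f_0(b_0)\cdots f_n(b_n)$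 is defined for every index $n$ of the sequence and all $f_0,\dots,f_n\in\bigcup_{l=1}^{j}\mathcal G^{j}_l$. Let $S_j^{[m]}$ be the set of block sequences in $S_j$ of length $m$, and $S_{\le k}^{[m]}=\bigcup_{j=1}^kS_j^{[m]}$. For an infinite block sequence $(b_i)$ in $S_k$ and $1\le j\le k$, the *tetris subspace* $\mathrm{TS}_j(b_i)^{[m]}$ is the set of $(a_0,\dots,a_{m-1})\in S_j^{[m]}$ for which there are $0=n_0<n_1<\dots<n_m$, numbers $j_i\in\{0,\dots,k\}$ and maps $f_i\in\mathcal G^{k}_{j_i}$ ($i<n_m$) such that for every $d<m$ one has $\max\{j_{n_d},\dots,j_{n_{d+1}-1}\}=j$, the product $f_{n_d}(b_{n_d})\cdots f_{n_{d+1}-1}(b_{n_{d+1}-1})$ is defined, and it equals $a_d$. **Theorem.** Let $S$ be a layered partial semigroup with $k$ layers endowed with a tetris action, let $m\ge 1$, and let a finite coloring of $S_{\le k}^{[m]}$ be given. Then there is an infinite block sequence $(b_n)$ in $S_k$ such that $f_0(b_0)\cdots f_n(b_n)$ is defined for every $n$ and all $f_0,\dots,f_n\in\bigcup_{l=0}^{k}\mathcal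 G^{k}_l$, and such that $\mathrm{TS}_j(b_n)^{[m]}$ is monochromatic for every $j=1,\dots,k$. -/

import Mathlib

/-- A partial semigroup: `op x y = some z` means that `xy` is defined and equals `z`, and
`op x y = none` means that `xy` is undefined. Associativity: `(xy)z` is defined if and only if
`x(yz)` is, and in that case they are equal. -/
class PartialSemigroup (S : Type*) where
  op : S → S → Option S
  assoc : ∀ x y z : S, ((op x y).bind fun w => op w z) = ((op y z).bind fun w => op x w)

namespace PartialSemigroup

variable {S : Type*} [PartialSemigroup S]

/-- `A` is closed under all defined products, so that it is a partial semigroup under the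
inherited operation. -/
def IsClosedUnderOp (A : Set S) : Prop :=
  ∀ x ∈ A, ∀ y ∈ A, ∀ z, op x y = some z → z ∈ A

/-- For `F ⊆ A`, the set of `y ∈ A` such that `xy` is defined for every `x ∈ F`. -/
def phi (A F : Set S) : Set S :=
  {y | y ∈ A ∧ ∀ x ∈ F, (op x y).isSome}

/-- `A`, with the inherited operation, is an adequate (directed) partial semigroup. -/
def IsAdequate (A : Set S) : Prop :=
  IsClosedUnderOp A ∧ ∀ F : Set S, F.Finite → F ⊆ A → (phi A F).Nonempty

/-- `σ` restricts to a partial semigroup homomorphism from `A` to `B`. -/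
def IsHom (σ : S → S) (A B : Set S) : Prop :=
  Set.MapsTo σ A B ∧
    ∀ x ∈ A, ∀ y ∈ A, ∀ z, op x y = some z → op (σ x) (σ y) = some (σ z)

/-- `σ` restricts to an adequate partial semigroup homomorphism from `A` to `B`. -/
def IsAdequateHom (σ : S → S) (A B : Set S) : Prop :=
  IsHom σ A B ∧
    ∀ F : Set S, F.Finite → F ⊆ B →
      ∃ H : Set S, H.Finite ∧ H ⊆ A ∧ σ '' phi A H ⊆ phi B F

/-- `A` is an adequate partial subsemigroup of `B`: it is an adequate partial semigroup under
the inherited operation, and the inclusion map is an adequate homomorphism. -/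
def IsAdequateSub (A B : Set S) : Prop :=
  IsAdequate A ∧ IsAdequateHom id A B

/-- `A` is an adequate ideal of `B`. -/
def IsAdequateIdeal (A B : Set S) : Prop :=
  IsAdequateSub A B ∧
    ∀ x ∈ A, ∀ y ∈ B, ∀ z, (op x y = some z → z ∈ A) ∧ (op y x = some z → z ∈ A)

/-- `e` is an identity element. -/
def IsIdentity (e : S) : Prop :=
  ∀ x : S, op e x = some x ∧ op x e = some x

/-- `IsProd x p q y`, for `p < q`: the product `x p ⋯ x (q - 1)` is defined and equal to `y`. -/
inductive IsProd (x : ℕ → S) (p : ℕ) : ℕ → S → Prop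
  | single : IsProd x p (p + 1) (x p)
  | snoc {q : ℕ} {y z : S} : IsProd x p q y → op y (x q) = some z → IsProd x p (q + 1) z

end PartialSemigroup

open PartialSemigroup in
/-- A layered partial semigroup with `k` layers. Only `layer 0, …, layer k` are meaningful. -/
structure LayeredPartialSemigroup (S : Type*) [PartialSemigroup S] (k : ℕ) where
  layer : ℕ → Set S
  cover : ∀ x : S, ∃ i ≤ k, x ∈ layer i
  disjoint : ∀ i ≤ k, ∀ j ≤ k, i ≠ j → Disjoint (layer i) (layer j)
  layer_zero : ∃ e : S, IsIdentity e ∧ layer 0 = {e}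
  adequate_upTo : ∀ n, 1 ≤ n → n ≤ k → IsAdequate {x | ∃ i ≤ n, x ∈ layer i}
  adequate_layer : ∀ n, 1 ≤ n → n ≤ k → IsAdequateSub (layer n) Set.univ
  ideal_layer : ∀ n, 1 ≤ n → n ≤ k → IsAdequateIdeal (layer n) {x | ∃ i ≤ n, x ∈ layer i}

/-- The union of the layers `0, …, n`. -/
def LayeredPartialSemigroup.upTo {S : Type*} [PartialSemigroup S] {k : ℕ}
    (L : LayeredPartialSemigroup S k) (n : ℕ) : Set S :=
  {x | ∃ i ≤ n, x ∈ L.layer i}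

open PartialSemigroup in
/-- A tetris action on a layered partial semigroup. A map defined on `L.upTo n` is represented by
a function `S → S`, whose values outside `L.upTo n` play no role. Only `F n` and `M n` with
`1 ≤ n ≤ k` are meaningful. -/
structure TetrisAction {S : Type*} [PartialSemigroup S] {k : ℕ}
    (L : LayeredPartialSemigroup S k) where
  F : ℕ → Set (S → S)
  M : ℕ → Set S
  F_finite : ∀ n, 1 ≤ n → n ≤ k → (F n).Finite
  F_nonempty : ∀ n, 1 ≤ n → n ≤ k → (F n).Nonempty
  F_hom : ∀ n, n + 1 ≤ k → ∀ σ ∈ F (n + 1), IsHom σ (L.upTo (n + 1)) (L.upTo n)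
  M_adequate : ∀ n, 1 ≤ n → n ≤ k → IsAdequateSub (M n) (L.layer n)
  image_M : ∀ n, 1 ≤ n → n + 1 ≤ k → ∀ σ ∈ F (n + 1), IsAdequateSub (σ '' M (n + 1)) (M n)
  image_layer : ∀ n, 1 ≤ n → n + 1 ≤ k → ∀ σ ∈ F (n + 1),
    IsAdequateSub (σ '' L.layer (n + 1)) (L.layer n)
  restrict : ∀ n, 1 ≤ n → n + 1 ≤ k → ∀ σ ∈ F (n + 1),
    (∃ τ ∈ F n, Set.EqOn σ τ (L.upTo n)) ∨ Set.EqOn σ id (L.upTo n)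
  agree_M : ∀ n, 1 ≤ n → n + 1 ≤ k → ∀ σ₁ ∈ F (n + 1), ∀ σ₂ ∈ F (n + 1),
    Set.EqOn σ₁ σ₂ (M (n + 1))

namespace TetrisAction

open PartialSemigroup

variable {S : Type*} [PartialSemigroup S] {k : ℕ} {L : LayeredPartialSemigroup S k}

/-- `𝒜.G j n g`: `g` is a map `σ (n+1) ∘ σ (n+2) ∘ ⋯ ∘ σ j` from layer `j` to layer `n`, where
`σ i ∈ F i` for every `i` (for `n = j` this is the identity map). -/
inductive G (𝒜 : TetrisAction L) (j : ℕ) : ℕ → (S → S) → Prop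
  | id : G 𝒜 j j id
  | comp {n : ℕ} {σ g : S → S} : σ ∈ 𝒜.F (n + 1) → G 𝒜 j (n + 1) g → G 𝒜 j n (σ ∘ g)

/-- `(b n)` is an infinite block sequence in layer `j`: the product `f 0 (b 0) ⋯ f n (b n)` is
defined for all `n` and all maps `f 0, …, f n` in the union of `G j 1, …, G j j`. -/
def IsBlockSeq (𝒜 : TetrisAction L) (j : ℕ) (b : ℕ → S) : Prop :=
  (∀ i, b i ∈ L.layer j) ∧
    ∀ (n : ℕ) (f : ℕ → S → S), (∀ i ≤ n, ∃ l, 1 ≤ l ∧ l ≤ j ∧ 𝒜.G j l (f i)) →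
      ∃ y, IsProd (fun i => f i (b i)) 0 (n + 1) y

/-- The set of block sequences in layer `j` of length `m`. -/
def blocks (𝒜 : TetrisAction L) (j m : ℕ) : Set (Fin m → S) :=
  {a | (∀ i, a i ∈ L.layer j) ∧
    ∀ (n : ℕ) (f : ℕ → S → S) (x : ℕ → S), n < m →
      (∀ i : Fin m, (i : ℕ) ≤ n →
        (∃ l, 1 ≤ l ∧ l ≤ j ∧ 𝒜.G j l (f i)) ∧ x i = f i (a i)) →
      ∃ y, IsProd x 0 (n + 1) y}

/-- The union, over `1 ≤ j ≤ n`, of the sets of block sequences in layer `j` of length `m`. -/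
def blocksUpTo (𝒜 : TetrisAction L) (n m : ℕ) : Set (Fin m → S) :=
  {a | ∃ j, 1 ≤ j ∧ j ≤ n ∧ a ∈ 𝒜.blocks j m}

/-- The tetris subspace of the `j`-th layer, in dimension `m`, generated by a block sequence
`(b n)` in the top layer `k`. The numbers `c 0 = 0 < c 1 < ⋯ < c m` are the cut points. -/
def tetrisSubspace (𝒜 : TetrisAction L) (j m : ℕ) (b : ℕ → S) : Set (Fin m → S) :=
  {a | a ∈ 𝒜.blocks j m ∧
    ∃ (c : Fin (m + 1) → ℕ) (l : ℕ → ℕ) (f : ℕ → S → S),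
      c 0 = 0 ∧ StrictMono c ∧
      (∀ i < c (Fin.last m), l i ≤ k ∧ 𝒜.G k (l i) (f i)) ∧
      ∀ d : Fin m,
        IsGreatest (l '' Set.Ico (c d.castSucc) (c d.succ)) j ∧
        IsProd (fun i => f i (b i)) (c d.castSucc) (c d.succ) (a d)}

end TetrisAction

/-! This is a Galvin–Glazer argument with one idempotent ultrafilter `u l` per layer. Undefined
products are sent to an absorbing point, so ultrafilters on `WithUndef S` form a compact semigroup.
In it the ultrafilters cofinite on layer `l` form a nonempty closed set; products go to the higher
layer, and lowering maps act continuously and multiplicatively on these sets. The algebraic core,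
`Compatible.exists_isAbsorbing`, yields `u` with `u i * u j = u (max i j)` and with every lowering
map sending `u (l + 1)` to `u l`. So for `b` generic for `u k`, an image of `b` in layer `l` is
generic for `u l`, and a product of such images with highest layer `j` is generic for `u j`. An
iterated ultrafilter quantifier selects one colour per `j` (`exists_iterEventually`). The sequence
is chosen term by term so that each of the finitely many partially built words can still be
completed to one of that colour. A `Stage` records such a partial word; `Promising.mulRight` shows
that another factor preserves completability. -/

/-! ### Chains of idempotents and running products -/

section Chains

variable {X : Type*} [Semigroup X]

/-- `z 0 ≥ z 1 ≥ ⋯ ≥ z n` in the order of idempotents. -/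
def IsAbsorbing (n : ℕ) (z : ℕ → X) : Prop :=
  ∀ j ≤ n, ∀ i ≤ j, z i * z j = z j ∧ z j * z i = z j

/-- The products `z n * z (n + 1) * ⋯ * z j` for `n < j`, and `z j` for `j ≤ n`. -/
def ascendingProd (n : ℕ) (z : ℕ → X) : ℕ → X
  | 0 => z 0
  | j + 1 => if j + 1 ≤ n then z (j + 1) else ascendingProd n z j * z (j + 1)

/-- The products `z j * z (j - 1) * ⋯ * z n` for `n < j`, and `z j` for `j ≤ n`. -/
def descendingProd (n : ℕ) (z : ℕ → X) : ℕ → X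
  | 0 => z 0
  | j + 1 => if j + 1 ≤ n then z (j + 1) else z (j + 1) * descendingProd n z j

theorem ascendingProd_of_le {n : ℕ} {z : ℕ → X} {j : ℕ} (h : j ≤ n) :
    ascendingProd n z j = z j := by
  cases j with
  | zero => rfl
  | succ j => simp [ascendingProd, h]

theorem ascendingProd_succ {n : ℕ} {z : ℕ → X} {j : ℕ} (h : n ≤ j) :
    ascendingProd n z (j + 1) = ascendingProd n z j * z (j + 1) := by
  have : ¬ j + 1 ≤ n := by omega
  simp [ascendingProd, this]

theorem descendingProd_of_le {n : ℕ} {z : ℕ → X} {j : ℕ} (h : j ≤ n) :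
    descendingProd n z j = z j := by
  cases j with
  | zero => rfl
  | succ j => simp [descendingProd, h]

theorem descendingProd_succ {n : ℕ} {z : ℕ → X} {j : ℕ} (h : n ≤ j) :
    descendingProd n z (j + 1) = z (j + 1) * descendingProd n z j := by
  have : ¬ j + 1 ≤ n := by omega
  simp [descendingProd, this]

theorem IsAbsorbing.congr {n : ℕ} {z w : ℕ → X} (hz : IsAbsorbing n z)
    (h : ∀ i ≤ n, w i = z i) : IsAbsorbing n w := by
  intro j hj i hi
  rw [h j hj, h i (by omega)]
  exact hz j hj i hi

end Chains

/-! ### Compatible absorbing chains in compact layered semigroups -/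

/-- A semigroup with closed layers `K 0, …, K k`, where `K 0` is trivial and products go to the
higher layer, together with sets `Φ n` of continuous maps that lower layer `n` by one, are
multiplicative on the layers up to `n`, and restrict on the layers below `n` to elements of
`Φ (n - 1)` or to the identity. -/
structure LayeredAction (X : Type*) [Semigroup X] [TopologicalSpace X] (k : ℕ) where
  K : ℕ → Set X
  Φ : ℕ → Set (X → X)
  isClosed_K : ∀ i ≤ k, IsClosed (K i)
  mul_mem : ∀ i ≤ k, ∀ j ≤ k, ∀ x ∈ K i, ∀ y ∈ K j, x * y ∈ K (max i j)
  zero_subsingleton : (K 0).Subsingleton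
  continuous_map : ∀ n, n + 1 ≤ k → ∀ σ ∈ Φ (n + 1), Continuous σ
  map_mem : ∀ n, n + 1 ≤ k → ∀ σ ∈ Φ (n + 1), ∀ x ∈ K (n + 1), σ x ∈ K n
  map_mul : ∀ n, n + 1 ≤ k → ∀ σ ∈ Φ (n + 1), ∀ i ≤ n + 1, ∀ j ≤ n + 1,
    ∀ x ∈ K i, ∀ y ∈ K j, σ (x * y) = σ x * σ y
  restrict : ∀ n, 1 ≤ n → n + 1 ≤ k → ∀ σ ∈ Φ (n + 1),
    (∃ τ ∈ Φ n, ∀ x ∈ K n, σ x = τ x) ∨ ∀ x ∈ K n, σ x = x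

namespace LayeredAction

variable {X : Type*} [Semigroup X] [TopologicalSpace X] {k : ℕ} (A : LayeredAction X k)

/-- A choice of one element in each layer that is preserved by the lowering maps. -/
def Compatible (z : ℕ → X) : Prop :=
  (∀ i ≤ k, z i ∈ A.K i) ∧ ∀ n, n + 1 ≤ k → ∀ σ ∈ A.Φ (n + 1), σ (z (n + 1)) = z n

variable {A}

theorem Compatible.mul {z w : ℕ → X} (hz : A.Compatible z) (hw : A.Compatible w) :
    A.Compatible (z * w) := by
  refine ⟨fun i hi => ?_, fun n hn σ hσ => ?_⟩
  · simpa using A.mul_mem i hi i hi _ (hz.1 i hi) _ (hw.1 i hi)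
  · simp only [Pi.mul_apply]
    rw [A.map_mul n hn σ hσ _ le_rfl _ le_rfl _ (hz.1 _ hn) _ (hw.1 _ hn), hz.2 n hn σ hσ,
      hw.2 n hn σ hσ]

theorem ascendingProd_mem {z : ℕ → X} (hz : A.Compatible z) (n : ℕ) :
    ∀ j ≤ k, ascendingProd n z j ∈ A.K j
  | 0, h => hz.1 0 h
  | j + 1, h => by
    rcases le_or_gt (j + 1) n with hj | hj
    · rw [ascendingProd_of_le hj]
      exact hz.1 _ h
    · rw [ascendingProd_succ (by omega)]
      simpa using A.mul_mem j (by omega) (j + 1) h _ (ascendingProd_mem hz n j (by omega)) _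
        (hz.1 _ h)

theorem descendingProd_mem {z : ℕ → X} (hz : A.Compatible z) (n : ℕ) :
    ∀ j ≤ k, descendingProd n z j ∈ A.K j
  | 0, h => hz.1 0 h
  | j + 1, h => by
    rcases le_or_gt (j + 1) n with hj | hj
    · rw [descendingProd_of_le hj]
      exact hz.1 _ h
    · rw [descendingProd_succ (by omega)]
      simpa using A.mul_mem (j + 1) h j (by omega) _ (hz.1 _ h) _
        (descendingProd_mem hz n j (by omega))

/-- A map lowering the last factor from layer `j + 2` to `j + 1` either lowers the preceding product
as well, giving the product one shorter, or fixes it, so that `z (j + 1)` is repeated and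
idempotency removes it. At the boundary `j + 1 = n`, absorption does the work. -/
theorem Compatible.ascending {z : ℕ → X} (hz : A.Compatible z)
    (hidem : ∀ i ≤ k, z i * z i = z i) {n : ℕ} (hn : IsAbsorbing n z) :
    A.Compatible (ascendingProd n z) := by
  refine ⟨ascendingProd_mem hz n, fun j => ?_⟩
  induction j with
  | zero =>
    intro hj σ hσ
    exact A.zero_subsingleton (A.map_mem 0 hj σ hσ _ (ascendingProd_mem hz n _ hj))
      (hz.1 0 (by omega))
  | succ j ih =>
    intro hj σ hσ
    rcases le_or_gt (j + 1 + 1) n with hjn | hjn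
    · rw [ascendingProd_of_le hjn, ascendingProd_of_le (by omega), hz.2 _ hj σ hσ]
    have hmem := ascendingProd_mem hz n (j + 1) (by omega)
    rw [ascendingProd_succ (by omega), A.map_mul _ hj σ hσ (j + 1) (by omega) _ le_rfl _ hmem _
      (hz.1 _ hj), hz.2 _ hj σ hσ]
    rcases A.restrict (j + 1) (by omega) hj σ hσ with ⟨τ, hτ, h⟩ | h
    · rw [h _ hmem, ih (by omega) τ hτ]
      rcases le_or_gt n j with h' | h'
      · rw [ascendingProd_succ h']
      · rw [ascendingProd_of_le (by omega), ascendingProd_of_le (by omega),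
          (hn (j + 1) (by omega) j (by omega)).1]
    · rw [h _ hmem]
      rcases le_or_gt n j with h' | h'
      · rw [ascendingProd_succ h', mul_assoc, hidem _ (by omega)]
      · rw [ascendingProd_of_le (by omega), hidem _ (by omega)]

theorem Compatible.descending {z : ℕ → X} (hz : A.Compatible z)
    (hidem : ∀ i ≤ k, z i * z i = z i) {n : ℕ} (hn : IsAbsorbing n z) :
    A.Compatible (descendingProd n z) := by
  refine ⟨descendingProd_mem hz n, fun j => ?_⟩
  induction j with
  | zero =>
    intro hj σ hσ
    exact A.zero_subsingleton (A.map_mem 0 hj σ hσ _ (descendingProd_mem hz n _ hj))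
      (hz.1 0 (by omega))
  | succ j ih =>
    intro hj σ hσ
    rcases le_or_gt (j + 1 + 1) n with hjn | hjn
    · rw [descendingProd_of_le hjn, descendingProd_of_le (by omega), hz.2 _ hj σ hσ]
    have hmem := descendingProd_mem hz n (j + 1) (by omega)
    rw [descendingProd_succ (by omega), A.map_mul _ hj σ hσ _ le_rfl (j + 1) (by omega) _
      (hz.1 _ hj) _ hmem, hz.2 _ hj σ hσ]
    rcases A.restrict (j + 1) (by omega) hj σ hσ with ⟨τ, hτ, h⟩ | h
    · rw [h _ hmem, ih (by omega) τ hτ]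
      rcases le_or_gt n j with h' | h'
      · rw [descendingProd_succ h']
      · rw [descendingProd_of_le (by omega), descendingProd_of_le (by omega),
          (hn (j + 1) (by omega) j (by omega)).2]
    · rw [h _ hmem]
      rcases le_or_gt n j with h' | h'
      · rw [descendingProd_succ h', ← mul_assoc, hidem _ (by omega)]
      · rw [descendingProd_of_le (by omega), hidem _ (by omega)]

theorem isClosed_setOf_compatible [T2Space X] : IsClosed {z | A.Compatible z} := by
  simp only [Compatible, Set.ofPred_and, Set.ofPred_forall]
  refine IsClosed.inter ?_ ?_
  · exact isClosed_iInter fun i => isClosed_iInter fun hi =>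
      (A.isClosed_K i hi).preimage (continuous_apply i)
  · exact isClosed_iInter fun n => isClosed_iInter fun hn => isClosed_iInter fun σ =>
      isClosed_iInter fun hσ => isClosed_eq
        ((A.continuous_map n hn σ hσ).comp (continuous_apply (n + 1))) (continuous_apply n)

theorem isClosed_setOf_compatible_eqOn [T2Space X] (n : ℕ) (z : ℕ → X) :
    IsClosed {x | A.Compatible x ∧ ∀ i ≤ n, x i = z i} := by
  simp only [Set.ofPred_and, Set.ofPred_forall]
  exact isClosed_setOf_compatible.inter <| isClosed_iInter fun i => isClosed_iInter fun _ =>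
    isClosed_eq (continuous_apply i) continuous_const

/-- Only right translations are continuous, so `x (n + 1) * z n = x (n + 1)` is a closed condition,
while its left analogue need not be. The right condition is secured by the idempotent theorem, the
left one afterwards by multiplying on the left. -/
theorem Compatible.exists_isAbsorbing_succ [CompactSpace X] [T2Space X]
    (hc : ∀ x : X, Continuous (· * x)) {n : ℕ} {z : ℕ → X}
    (hz : A.Compatible z) (habs : IsAbsorbing n z) :
    ∃ w, A.Compatible w ∧ IsAbsorbing (n + 1) w := by
  have hcont : ∀ x : ℕ → X, Continuous (· * x) := fun x =>
    continuous_pi fun i => (hc (x i)).comp (continuous_apply i)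
  have hzidem : ∀ i ≤ n, z i * z i = z i := fun i hi => (habs i hi i le_rfl).1
  obtain ⟨x, ⟨hx, hxz⟩, hxx⟩ := exists_idempotent_in_compact_subsemigroup hcont
    {x | A.Compatible x ∧ ∀ i ≤ n, x i = z i} ⟨z, hz, fun _ _ => rfl⟩
    (isClosed_setOf_compatible_eqOn n z).isCompact
    (fun x hx y hy => ⟨hx.1.mul hy.1, fun i hi => by
      rw [Pi.mul_apply, hx.2 i hi, hy.2 i hi, hzidem i hi]⟩)
  -- The first idempotent `x` serves to make the descending products compatible; their entry `x (n +
  -- 1) * z n` shows that the second closed subsemigroup is nonempty.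
  obtain ⟨w, ⟨⟨hw, hwz⟩, hwn⟩, hww⟩ := exists_idempotent_in_compact_subsemigroup hcont
    ({x | A.Compatible x ∧ ∀ i ≤ n, x i = z i} ∩ {x | x (n + 1) * z n = x (n + 1)})
    ⟨descendingProd n x,
      ⟨hx.descending (fun i _ => congrFun hxx i) (habs.congr hxz), fun i hi => by
        rw [descendingProd_of_le hi, hxz i hi]⟩, by
      simp only [Set.mem_ofPred_eq]
      rw [descendingProd_succ le_rfl, descendingProd_of_le le_rfl, hxz n le_rfl, mul_assoc,
        hzidem n le_rfl]⟩
    ((isClosed_setOf_compatible_eqOn n z).inter (isClosed_eq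
      ((hc (z n)).comp (continuous_apply (n + 1))) (continuous_apply (n + 1)))).isCompact
    (fun x hx y hy => ⟨⟨hx.1.1.mul hy.1.1, fun i hi => by
      rw [Pi.mul_apply, hx.1.2 i hi, hy.1.2 i hi, hzidem i hi]⟩, by
      have := hy.2
      simp only [Set.mem_ofPred_eq, Pi.mul_apply] at this ⊢
      rw [mul_assoc, this]⟩)
  simp only [Set.mem_ofPred_eq] at hwn
  have hwidem : ∀ i, w i * w i = w i := fun i => congrFun hww i
  have habsw := habs.congr hwz
  -- The new entry is `z n * w (n + 1)`; it is idempotent because `w (n + 1) * z n = w (n + 1)`.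
  refine ⟨ascendingProd n w, hw.ascending (fun i _ => hwidem i) habsw, fun j hj i hi => ?_⟩
  rcases Nat.lt_or_ge n j with hnj | hjn
  · obtain rfl : j = n + 1 := by omega
    rw [ascendingProd_succ le_rfl, ascendingProd_of_le le_rfl, hwz n le_rfl]
    rcases Nat.lt_or_ge n i with hni | hin
    · obtain rfl : i = n + 1 := by omega
      rw [ascendingProd_succ le_rfl, ascendingProd_of_le le_rfl, hwz n le_rfl]
      have : z n * w (n + 1) * (z n * w (n + 1)) = z n * w (n + 1) := by
        rw [← mul_assoc, mul_assoc _ _ (z n), hwn, mul_assoc, hwidem]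
      exact ⟨this, this⟩
    · rw [ascendingProd_of_le hin, hwz i hin]
      have h := habs n le_rfl i hin
      refine ⟨by rw [← mul_assoc, h.1], ?_⟩
      rw [← hwn, mul_assoc, mul_assoc, h.2]
  · rw [ascendingProd_of_le hjn, ascendingProd_of_le (by omega)]
    exact habsw j hjn i hi

theorem Compatible.exists_isAbsorbing [CompactSpace X] [T2Space X]
    (hc : ∀ x : X, Continuous (· * x)) {z : ℕ → X} (hz : A.Compatible z)
    (h0 : z 0 * z 0 = z 0) : ∃ w, A.Compatible w ∧ IsAbsorbing k w := by
  suffices ∀ n, ∃ w, A.Compatible w ∧ IsAbsorbing n w from this k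
  intro n
  induction n with
  | zero =>
    refine ⟨z, hz, fun j hj i hi => ?_⟩
    obtain rfl : j = 0 := by omega
    obtain rfl : i = 0 := by omega
    exact ⟨h0, h0⟩
  | succ n ih =>
    obtain ⟨w, hw, hw'⟩ := ih
    exact hw.exists_isAbsorbing_succ hc hw'

end LayeredAction

/-! ### Ultrafilters on a partial semigroup with an undefined element -/

section Proof

open Filter

/-- A partial semigroup with an added absorbing element `none`, which is the value of all
undefined products. -/
def WithUndef (S : Type*) := Option S

attribute [local instance] Ultrafilter.semigroup

namespace WithUndef

open PartialSemigroup

variable {S : Type*}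

/-- An element of the partial semigroup. -/
def of (x : S) : WithUndef S := some x

/-- The undefined element. -/
def undef : WithUndef S := none

theorem ne_undef_iff {x : WithUndef S} : x ≠ undef ↔ ∃ a, x = of a := Option.ne_none_iff_exists'

/-- The extension of a map by `undef ↦ undef`. -/
def map (σ : S → S) : WithUndef S → WithUndef S := Option.map σ

theorem map_of (σ : S → S) (x : S) : map σ (of x) = of (σ x) := rfl

theorem map_id : map (id : S → S) = id := Option.map_id

theorem map_comp (σ τ : S → S) : map (σ ∘ τ) = map σ ∘ map τ := (Option.map_comp_map τ σ).symm

variable [PartialSemigroup S]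

instance : Semigroup (WithUndef S) where
  mul x y := Option.bind x fun a => Option.bind y fun b => op a b
  mul_assoc x y z := by
    change Option.bind (Option.bind x _) _ = Option.bind x _
    rcases x with _ | x
    · rfl
    rcases y with _ | y
    · rfl
    rcases z with _ | z
    · change Option.bind (op x y) (fun _ => none) = none
      cases op x y <;> rfl
    · exact assoc x y z

theorem of_mul_of_eq_of {x y z : S} : of x * of y = of z ↔ op x y = some z := Iff.rfl

theorem of_mul_of_ne_undef {x y : S} : of x * of y ≠ undef ↔ (op x y).isSome :=
  Option.isSome_iff_ne_none.symm

theorem of_mul_of_identity {e : S} (he : IsIdentity e) (x : WithUndef S) : x * of e = x := by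
  cases x with
  | none => rfl
  | some x => exact (he x).2

theorem of_identity_mul {e : S} (he : IsIdentity e) (x : WithUndef S) : of e * x = x := by
  cases x with
  | none => rfl
  | some x => exact (he x).1

end WithUndef

theorem Ultrafilter.continuous_map {α β : Type*} (f : α → β) :
    Continuous (Ultrafilter.map f) :=
  ultrafilterBasis_is_basis.continuous_iff.2 <| Set.forall_mem_range.mpr fun s =>
    ultrafilter_isOpen_basic (f ⁻¹' s)

theorem Ultrafilter.map_congr {α β : Type*} {f g : α → β} {U : Ultrafilter α}
    (h : ∀ᶠ x in U, f x = g x) : U.map f = U.map g :=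
  Ultrafilter.coe_inj.mp (Filter.map_congr h)

/-- Needed since a homomorphism may make an undefined product defined, so its extension to
`WithUndef S` need not be multiplicative everywhere. -/
theorem Ultrafilter.map_mul_of_eventually {α β : Type*} [Semigroup α] [Semigroup β] (f : α → β)
    (U V : Ultrafilter α) (h : ∀ᶠ x in U, ∀ᶠ y in V, f (x * y) = f x * f y) :
    (U * V).map f = U.map f * V.map f := by
  refine Ultrafilter.coe_inj.mp (Filter.ext' fun p => ?_)
  rw [Ultrafilter.eventually_mul]
  simp only [Ultrafilter.coe_map, eventually_map]
  rw [Ultrafilter.eventually_mul]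
  refine eventually_congr (h.mono fun x hx => eventually_congr (hx.mono fun y hy => ?_))
  rw [hy]

/-! ### Cofinite ultrafilters -/

namespace PartialSemigroup

open WithUndef

variable {S : Type*} [PartialSemigroup S]

/-- The cofinite ultrafilters on an adequate partial semigroup `A`. -/
def cofiniteUltrafilters (A : Set S) : Set (Ultrafilter (WithUndef S)) :=
  {U | (∀ᶠ y in U, ∃ a ∈ A, y = of a) ∧ ∀ x ∈ A, ∀ᶠ y in U, of x * y ≠ undef}

theorem isClosed_cofiniteUltrafilters (A : Set S) : IsClosed (cofiniteUltrafilters A) := by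
  simp only [cofiniteUltrafilters, Set.ofPred_and, Set.ofPred_forall]
  exact (ultrafilter_isClosed_basic {y | ∃ a ∈ A, y = of a}).inter <|
    isClosed_iInter fun x => isClosed_iInter fun _ =>
      ultrafilter_isClosed_basic {y | of x * y ≠ undef}

/-- Adequacy of the inclusion puts some `phi A H` with `H` finite inside `phi B {x}`, and a cofinite
ultrafilter on `A` contains `phi A H`. -/
theorem cofiniteUltrafilters_mono {A B : Set S} (h : IsAdequateSub A B) :
    cofiniteUltrafilters A ⊆ cofiniteUltrafilters B := by
  intro U hU
  refine ⟨hU.1.mono fun y ⟨a, ha, hy⟩ => ⟨a, h.2.1.1 ha, hy⟩, fun x hx => ?_⟩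
  obtain ⟨H, hHfin, hHA, hH⟩ := h.2.2 {x} (Set.finite_singleton x) (by simpa using hx)
  have : ∀ᶠ y in U, ∀ t ∈ H, of t * y ≠ undef :=
    (eventually_all_finite hHfin).2 fun t ht => hU.2 t (hHA ht)
  filter_upwards [this, hU.1] with y hy ⟨a, ha, hya⟩
  subst hya
  have : a ∈ phi A H := ⟨ha, fun t ht => of_mul_of_ne_undef.1 (hy t ht)⟩
  exact of_mul_of_ne_undef.2 ((hH ⟨a, this, rfl⟩).2 x rfl)

theorem map_mem_cofiniteUltrafilters {A : Set S} {σ : S → S}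
    (hσ : ∀ x ∈ A, ∀ y ∈ A, ∀ z, op x y = some z → op (σ x) (σ y) = some (σ z))
    {U : Ultrafilter (WithUndef S)} (hU : U ∈ cofiniteUltrafilters A) :
    U.map (WithUndef.map σ) ∈ cofiniteUltrafilters (σ '' A) := by
  refine ⟨?_, ?_⟩
  · rw [Ultrafilter.coe_map, eventually_map]
    exact hU.1.mono fun y ⟨a, ha, hy⟩ => ⟨σ a, ⟨a, ha, rfl⟩, by rw [hy, map_of]⟩
  · rintro _ ⟨x, hx, rfl⟩
    rw [Ultrafilter.coe_map, eventually_map]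
    filter_upwards [hU.1, hU.2 x hx] with y ⟨a, ha, hy⟩ hxy
    subst hy
    obtain ⟨z, hz⟩ := ne_undef_iff.1 hxy
    exact ne_undef_iff.2 ⟨σ z, hσ x hx a ha z hz⟩

/-- Adequacy is the finite intersection property for the sets that a cofinite ultrafilter must
contain. -/
theorem IsAdequate.cofiniteUltrafilters_nonempty {A : Set S} (h : IsAdequate A) :
    (cofiniteUltrafilters A).Nonempty := by
  obtain ⟨U, hU⟩ := Ultrafilter.exists_ultrafilter_of_finite_inter_nonempty
    (insert {y | ∃ a ∈ A, y = of a} ((fun x : S => {y | of x * y ≠ undef}) '' A)) (by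
      intro T hT
      obtain ⟨y₀, -⟩ := h.2 ∅ Set.finite_empty (Set.empty_subset A)
      have : Nonempty S := ⟨y₀⟩
      choose! f hf using fun t (ht : t ∈ (fun x : S => {y | of x * y ≠ undef}) '' A) => ht
      have hF : (f '' {t | t ∈ T ∧ t ∈ (fun x : S => {y | of x * y ≠ undef}) '' A}).Finite :=
        (T.finite_toSet.subset fun t ht => ht.1).image f
      obtain ⟨y, hyA, hy⟩ := h.2 _ hF (by
        rintro _ ⟨t, ht, rfl⟩
        exact (hf t ht.2).1)
      refine ⟨of y, fun t ht => ?_⟩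
      rcases hT ht with rfl | ht'
      · exact ⟨y, hyA, rfl⟩
      · rw [← (hf t ht').2]
        exact of_mul_of_ne_undef.2 (hy _ ⟨t, ⟨ht, ht'⟩, rfl⟩))
  exact ⟨U, hU (Set.mem_insert _ _), fun x hx => hU (Set.mem_insert_of_mem _ ⟨x, hx, rfl⟩)⟩

end PartialSemigroup

namespace LayeredPartialSemigroup

open PartialSemigroup WithUndef

variable {S : Type*} [PartialSemigroup S] {k : ℕ} (L : LayeredPartialSemigroup S k)

theorem layer_subset_upTo {i n : ℕ} (h : i ≤ n) : L.layer i ⊆ L.upTo n :=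
  fun _ hx => ⟨i, h, hx⟩

theorem mul_mem_layer {i j : ℕ} (hi : i ≤ k) (hj : j ≤ k) {x y z : S} (hx : x ∈ L.layer i)
    (hy : y ∈ L.layer j) (h : op x y = some z) : z ∈ L.layer (max i j) := by
  obtain ⟨e, he, h0⟩ := L.layer_zero
  rcases Nat.eq_zero_or_pos (max i j) with hm | hm
  · obtain rfl : i = 0 := by omega
    obtain rfl : j = 0 := by omega
    rw [h0, Set.mem_singleton_iff] at hx hy
    subst hx hy
    rw [(he _).1, Option.some_inj] at h
    simp [h0, h]
  · have hid := (L.ideal_layer (max i j) hm (by omega)).2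
    rcases le_total i j with hij | hij
    · rw [max_eq_right hij] at hid ⊢
      exact (hid y hy x ⟨i, hij, hx⟩ z).2 h
    · rw [max_eq_left hij] at hid ⊢
      exact (hid x hx y ⟨j, hij, hy⟩ z).1 h

theorem cofiniteUltrafilters_layer_zero {e : S} (he : IsIdentity e) (h0 : L.layer 0 = {e}) :
    cofiniteUltrafilters (L.layer 0) = {pure (of e)} := by
  ext U
  constructor
  · intro hU
    refine (Ultrafilter.eq_of_le ?_)
    rw [Ultrafilter.coe_pure, le_pure_iff]
    refine hU.1.mono fun y hy => ?_
    change y = of e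
    simpa [h0] using hy
  · rintro rfl
    simp only [cofiniteUltrafilters, h0, Set.mem_ofPred_eq, Ultrafilter.coe_pure,
      eventually_pure]
    exact ⟨⟨e, rfl, rfl⟩, fun x hx => ne_undef_iff.2 ⟨x, (he x).2⟩⟩

/-- Here `x` may lie in any layer, since positive layers are adequate in all of `S`. This makes
products across layers defined almost everywhere. -/
theorem eventually_mul_ne_undef {i : ℕ} (hi : i ≤ k) {U : Ultrafilter (WithUndef S)}
    (hU : U ∈ cofiniteUltrafilters (L.layer i)) (x : S) : ∀ᶠ y in U, of x * y ≠ undef := by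
  rcases Nat.eq_zero_or_pos i with rfl | h
  · obtain ⟨e, he, h0⟩ := L.layer_zero
    refine hU.1.mono fun y ⟨a, ha, hy⟩ => ?_
    rw [h0, Set.mem_singleton_iff] at ha
    exact hy ▸ ha ▸ ne_undef_iff.2 ⟨x, (he x).2⟩
  · exact (cofiniteUltrafilters_mono (L.adequate_layer i h hi) hU).2 x (Set.mem_univ x)

theorem eventually_mul_eq_of {i j : ℕ} (hj : j ≤ k) {U V : Ultrafilter (WithUndef S)}
    (hU : U ∈ cofiniteUltrafilters (L.layer i)) (hV : V ∈ cofiniteUltrafilters (L.layer j)) :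
    ∀ᶠ x in U, ∀ᶠ y in V, ∃ a ∈ L.layer i, ∃ b ∈ L.layer j, ∃ c,
      x = of a ∧ y = of b ∧ op a b = some c := by
  refine hU.1.mono fun x ⟨a, ha, hx⟩ => ?_
  filter_upwards [hV.1, L.eventually_mul_ne_undef hj hV a] with y ⟨b, hb, hy⟩ hab
  subst hy
  obtain ⟨c, hc⟩ := ne_undef_iff.1 hab
  exact ⟨a, ha, b, hb, c, hx, rfl, hc⟩

theorem mul_mem_cofiniteUltrafilters {i j : ℕ} (hi : i ≤ k) (hj : j ≤ k)
    {U V : Ultrafilter (WithUndef S)} (hU : U ∈ cofiniteUltrafilters (L.layer i))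
    (hV : V ∈ cofiniteUltrafilters (L.layer j)) :
    U * V ∈ cofiniteUltrafilters (L.layer (max i j)) := by
  constructor
  · rw [Ultrafilter.eventually_mul]
    refine (L.eventually_mul_eq_of hj hU hV).mono fun x hx => hx.mono ?_
    rintro y ⟨a, ha, b, hb, c, rfl, rfl, hc⟩
    exact ⟨c, L.mul_mem_layer hi hj ha hb hc, hc⟩
  · intro x _
    rw [Ultrafilter.eventually_mul]
    refine (L.eventually_mul_ne_undef hi hU x).mono fun y hy => ?_
    obtain ⟨w, hw⟩ := ne_undef_iff.1 hy
    refine (L.eventually_mul_ne_undef hj hV w).mono fun z hz => ?_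
    rwa [← mul_assoc, hw]

end LayeredPartialSemigroup

/-! ### The tetris action on cofinite ultrafilters -/

namespace TetrisAction

open PartialSemigroup WithUndef

variable {S : Type*} [PartialSemigroup S] {k : ℕ} {L : LayeredPartialSemigroup S k}
  (𝒜 : TetrisAction L)

theorem map_mem_cofiniteUltrafilters_layer {n : ℕ} (hn : n + 1 ≤ k) {σ : S → S}
    (hσ : σ ∈ 𝒜.F (n + 1)) {U : Ultrafilter (WithUndef S)}
    (hU : U ∈ cofiniteUltrafilters (L.layer (n + 1))) :
    U.map (WithUndef.map σ) ∈ cofiniteUltrafilters (L.layer n) := by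
  have hhom := 𝒜.F_hom n hn σ hσ
  rcases Nat.eq_zero_or_pos n with rfl | h
  · obtain ⟨e, he, h0⟩ := L.layer_zero
    have hval : ∀ᶠ y in U, WithUndef.map σ y = of e := hU.1.mono fun y ⟨a, ha, hy⟩ => by
      obtain ⟨i, hi, hmem⟩ := hhom.1 (L.layer_subset_upTo le_rfl ha)
      obtain rfl : i = 0 := by omega
      rw [h0, Set.mem_singleton_iff] at hmem
      rw [hy, map_of, hmem]
    rw [L.cofiniteUltrafilters_layer_zero he h0, Set.mem_singleton_iff, Ultrafilter.map_congr hval]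
    exact Ultrafilter.eq_of_le (by simp)
  · refine cofiniteUltrafilters_mono (𝒜.image_layer n h hn σ hσ)
      (map_mem_cofiniteUltrafilters (fun x hx y hy z hz => ?_) hU)
    exact hhom.2 x (L.layer_subset_upTo le_rfl hx) y (L.layer_subset_upTo le_rfl hy) z hz

/-- The action induced by a tetris action on the cofinite ultrafilters on the layers. -/
def ultrafilterAction : LayeredAction (Ultrafilter (WithUndef S)) k where
  K i := cofiniteUltrafilters (L.layer i)
  Φ n := (fun σ U => Ultrafilter.map (WithUndef.map σ) U) '' 𝒜.F n
  isClosed_K _ _ := isClosed_cofiniteUltrafilters _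
  mul_mem _ hi _ hj _ hU _ hV := L.mul_mem_cofiniteUltrafilters hi hj hU hV
  zero_subsingleton := by
    obtain ⟨e, he, h0⟩ := L.layer_zero
    rw [L.cofiniteUltrafilters_layer_zero he h0]
    exact Set.subsingleton_singleton
  continuous_map := by
    rintro n hn _ ⟨σ, hσ, rfl⟩
    exact Ultrafilter.continuous_map _
  map_mem := by
    rintro n hn _ ⟨σ, hσ, rfl⟩ U hU
    exact 𝒜.map_mem_cofiniteUltrafilters_layer hn hσ hU
  map_mul := by
    rintro n hn _ ⟨σ, hσ, rfl⟩ i hi j hj U hU V hV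
    refine Ultrafilter.map_mul_of_eventually _ _ _
      ((L.eventually_mul_eq_of (hj.trans hn) hU hV).mono fun x hx => hx.mono ?_)
    rintro y ⟨a, ha, b, hb, c, rfl, rfl, hc⟩
    have := (𝒜.F_hom n hn σ hσ).2 a (L.layer_subset_upTo hi ha) b (L.layer_subset_upTo hj hb) c hc
    rw [of_mul_of_eq_of.2 hc, map_of, map_of, map_of, of_mul_of_eq_of.2 this]
  restrict := by
    rintro n h hn _ ⟨σ, hσ, rfl⟩
    refine (𝒜.restrict n h hn σ hσ).imp ?_ ?_
    · rintro ⟨τ, hτ, heq⟩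
      refine ⟨_, ⟨τ, hτ, rfl⟩, fun U hU => Ultrafilter.map_congr (hU.1.mono ?_)⟩
      rintro y ⟨a, ha, rfl⟩
      rw [map_of, map_of, heq (L.layer_subset_upTo le_rfl ha)]
    · intro heq U hU
      have : ∀ᶠ y in U, WithUndef.map σ y = id y := hU.1.mono fun y ⟨a, ha, hy⟩ => by
        rw [hy, map_of, heq (L.layer_subset_upTo le_rfl ha)]
        rfl
      exact (Ultrafilter.map_congr this).trans (Ultrafilter.map_id U)

theorem G.le {j n : ℕ} {g : S → S} (h : 𝒜.G j n g) : n ≤ j := by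
  induction h with
  | id => exact le_rfl
  | comp _ _ ih => omega

/-- Finiteness allows conditions for all maps to be imposed at once along an ultrafilter. -/
theorem finite_setOf_G {l : ℕ} (hl : l ≤ k) : {g | 𝒜.G k l g}.Finite := by
  induction hl using Nat.decreasingInduction with
  | self =>
    refine (Set.finite_singleton id).subset ?_
    rintro _ (_ | ⟨_, hg⟩)
    · rfl
    · have := hg.le
      omega
  | of_succ l hl ih =>
    refine (Set.Finite.image2 (fun σ g => σ ∘ g) (𝒜.F_finite (l + 1) (by omega) hl) ih).subset ?_
    rintro _ (_ | ⟨hσ, hg⟩)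
    · omega
    · exact ⟨_, hσ, _, hg, rfl⟩

theorem map_G {u : ℕ → Ultrafilter (WithUndef S)} (hu : 𝒜.ultrafilterAction.Compatible u)
    {l : ℕ} {g : S → S} (hg : 𝒜.G k l g) : (u k).map (WithUndef.map g) = u l := by
  induction hg with
  | id => rw [WithUndef.map_id, Ultrafilter.map_id]
  | comp hσ hg ih =>
    rw [WithUndef.map_comp, ← Ultrafilter.map_map, ih]
    exact hu.2 _ hg.le _ ⟨_, hσ, rfl⟩

/-- The set `M n` for `n ≥ 1`, and `{e}` for `n = 0`. -/
def core (n : ℕ) : Set S := if n = 0 then L.layer 0 else 𝒜.M n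

theorem cofiniteUltrafilters_core_subset {n : ℕ} (hn : n ≤ k) :
    cofiniteUltrafilters (𝒜.core n) ⊆ cofiniteUltrafilters (L.layer n) := by
  rcases Nat.eq_zero_or_pos n with rfl | h
  · rfl
  · rw [core, if_neg (by omega)]
    exact cofiniteUltrafilters_mono (𝒜.M_adequate n h hn)

theorem map_mem_cofiniteUltrafilters_core {n : ℕ} (hn : n + 1 ≤ k) {σ : S → S}
    (hσ : σ ∈ 𝒜.F (n + 1)) {U : Ultrafilter (WithUndef S)}
    (hU : U ∈ cofiniteUltrafilters (𝒜.core (n + 1))) :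
    U.map (WithUndef.map σ) ∈ cofiniteUltrafilters (𝒜.core n) := by
  rcases Nat.eq_zero_or_pos n with rfl | h
  · exact 𝒜.map_mem_cofiniteUltrafilters_layer hn hσ (𝒜.cofiniteUltrafilters_core_subset hn hU)
  · rw [core, if_neg (by omega)] at hU ⊢
    refine cofiniteUltrafilters_mono (𝒜.image_M n h hn σ hσ)
      (map_mem_cofiniteUltrafilters (fun x hx y hy z hz => ?_) hU)
    have hM := (𝒜.M_adequate (n + 1) (by omega) hn).2.1.1
    exact (𝒜.F_hom n hn σ hσ).2 x (L.layer_subset_upTo le_rfl (hM hx)) y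
      (L.layer_subset_upTo le_rfl (hM hy)) z hz

theorem map_eq_map_of_mem_core {n : ℕ} (hn : n + 1 ≤ k) {σ τ : S → S}
    (hσ : σ ∈ 𝒜.F (n + 1)) (hτ : τ ∈ 𝒜.F (n + 1)) {U : Ultrafilter (WithUndef S)}
    (hU : U ∈ cofiniteUltrafilters (𝒜.core (n + 1))) :
    U.map (WithUndef.map σ) = U.map (WithUndef.map τ) := by
  rcases Nat.eq_zero_or_pos n with rfl | h
  · have hU' := 𝒜.cofiniteUltrafilters_core_subset hn hU
    exact 𝒜.ultrafilterAction.zero_subsingleton (𝒜.map_mem_cofiniteUltrafilters_layer hn hσ hU')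
      (𝒜.map_mem_cofiniteUltrafilters_layer hn hτ hU')
  · rw [core, if_neg (by omega)] at hU
    refine Ultrafilter.map_congr (hU.1.mono ?_)
    rintro y ⟨a, ha, rfl⟩
    rw [map_of, map_of, 𝒜.agree_M n h hn σ hσ τ hτ ha]

/-- On the sets `M n` all lowering maps agree, so the image of `U` one layer down does not depend on
the map. The sets `M n` serve only to provide this starting sequence. -/
theorem exists_lowering_sequence {n : ℕ} (hn : n ≤ k) {U : Ultrafilter (WithUndef S)}
    (hU : U ∈ cofiniteUltrafilters (𝒜.core n)) :
    ∃ z : ℕ → Ultrafilter (WithUndef S), z n = U ∧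
      (∀ i ≤ n, z i ∈ cofiniteUltrafilters (L.layer i)) ∧
      ∀ i, i + 1 ≤ n → ∀ σ ∈ 𝒜.F (i + 1), (z (i + 1)).map (WithUndef.map σ) = z i := by
  induction n generalizing U with
  | zero =>
    refine ⟨fun _ => U, rfl, fun i hi => ?_, fun i hi => by omega⟩
    obtain rfl : i = 0 := by omega
    exact hU
  | succ n ih =>
    obtain ⟨σ, hσ⟩ := 𝒜.F_nonempty (n + 1) (by omega) hn
    obtain ⟨z, hz, hzmem, hzmap⟩ :=
      ih (by omega) (𝒜.map_mem_cofiniteUltrafilters_core hn hσ hU)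
    refine ⟨Function.update z (n + 1) U, by simp, fun i hi => ?_, fun i hi τ hτ => ?_⟩
    · rcases Nat.lt_or_ge n i with h | h
      · obtain rfl : i = n + 1 := by omega
        simpa using 𝒜.cofiniteUltrafilters_core_subset hn hU
      · rw [Function.update_of_ne (by omega)]
        exact hzmem i h
    · rw [Function.update_of_ne (by omega : i ≠ n + 1)]
      rcases Nat.lt_or_ge i n with h | h
      · rw [Function.update_of_ne (by omega)]
        exact hzmap i h τ hτ
      · obtain rfl : i = n := by omega
        rw [Function.update_self, hz, 𝒜.map_eq_map_of_mem_core hn hτ hσ hU]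

theorem cofiniteUltrafilters_core_nonempty : (cofiniteUltrafilters (𝒜.core k)).Nonempty := by
  rcases Nat.eq_zero_or_pos k with rfl | h
  · obtain ⟨e, he, h0⟩ := L.layer_zero
    rw [core, if_pos rfl, L.cofiniteUltrafilters_layer_zero he h0]
    exact Set.singleton_nonempty _
  · rw [core, if_neg (by omega)]
    exact (𝒜.M_adequate k h le_rfl).1.cofiniteUltrafilters_nonempty

/-- A descending chain of idempotent cofinite ultrafilters, one in each layer, that is preserved
by all tetris maps. -/
theorem exists_compatible_isAbsorbing :
    ∃ u, 𝒜.ultrafilterAction.Compatible u ∧ IsAbsorbing k u := by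
  obtain ⟨U, hU⟩ := 𝒜.cofiniteUltrafilters_core_nonempty
  obtain ⟨z, -, hz, hzmap⟩ := 𝒜.exists_lowering_sequence le_rfl hU
  refine LayeredAction.Compatible.exists_isAbsorbing Ultrafilter.continuous_mul_left
    (z := z) ⟨hz, ?_⟩ ?_
  · rintro n hn _ ⟨σ, hσ, rfl⟩
    exact hzmap n hn σ hσ
  · have h := hz 0 (Nat.zero_le k)
    exact 𝒜.ultrafilterAction.zero_subsingleton
      (L.mul_mem_cofiniteUltrafilters (Nat.zero_le k) (Nat.zero_le k) h h) h

end TetrisAction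

/-! ### Iterated ultrafilter quantifiers -/

namespace Ultrafilter

variable {T : Type*}

/-- `U`-almost all `y 0`, `U`-almost all `y 1`, …, `U`-almost all `y (n - 1)` are such that
`R [y 0, …, y (n - 1)]`. -/
def IterEventually (U : Ultrafilter T) : ℕ → (List T → Prop) → Prop
  | 0, R => R []
  | n + 1, R => ∀ᶠ y in U, IterEventually U n fun t => R (y :: t)

/-- An ultrafilter passes a finite disjunction to one of its members; this is applied at each of the
`n` quantifiers. -/
theorem exists_iterEventually (U : Ultrafilter T) {ι : Type*} [Finite ι] (n : ℕ)
    (R : ι → List T → Prop) (h : ∀ t, ∃ c, R c t) : ∃ c, U.IterEventually n (R c) := by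
  induction n generalizing R with
  | zero => exact h []
  | succ n ih =>
    exact eventually_exists_iff.1
      (Eventually.of_forall fun y => ih (fun c t => R c (y :: t)) fun t => h _)

end Ultrafilter

/-! ### Stages and the recursive choice of the sequence -/

/-- A stage in the construction of a finite sequence of elements of layer `target`. The current
element is being built as a product; so far it is `prod`, in layer `current`. After it,
`remaining` more elements are to be built, and the current element followed by
these has to satisfy `word`. -/
structure Stage (T : Type*) where
  target : ℕ
  remaining : ℕ
  word : List T → Prop
  prod : T
  current : ℕ

namespace Stage

variable {T : Type*} [Semigroup T]

/-- Multiply the current product by an element of layer `l`. -/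
def mulRight (s : Stage T) (y : T) (l : ℕ) : Stage T :=
  { s with prod := s.prod * y, current := max s.current l }

/-- Finish the current product and start a new one with the identity element `e`. -/
def finish (e : T) (s : Stage T) : Stage T where
  target := s.target
  remaining := s.remaining - 1
  word t := s.word (s.prod :: t)
  prod := e
  current := 0

/-- The stage can be completed by factors taken from the ultrafilters `u l`. -/
def Promising (u : ℕ → Ultrafilter T) (s : Stage T) : Prop :=
  -- Below the target layer only `l = s.target` qualifies; once the target is reached, every `l ≤
  -- s.target` does.
  ∀ l ≤ s.target, max s.current l = s.target →
    ∀ᶠ y in u l, (u s.target).IterEventually s.remaining fun t => s.word (s.prod * y :: t)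

variable {u : ℕ → Ultrafilter T} {k : ℕ} {e : T}

/-- A factor from layer `l` followed by one from `l'` acts as a single factor from layer `max l l'`,
because `u l * u l' = u (max l l')`. -/
theorem Promising.mulRight (habs : IsAbsorbing k u) {s : Stage T} (hs : s.Promising u)
    (hk : s.target ≤ k) {l : ℕ} (hl : l ≤ s.target) :
    ∀ᶠ y in u l, (s.mulRight y l).Promising u := by
  simp only [Promising, Stage.mulRight]
  refine (eventually_all_finite (Set.finite_Iic s.target)).2 fun l' hl' => ?_
  rw [Set.mem_Iic] at hl'
  by_cases hm : max (max s.current l) l' = s.target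
  · have h := hs (max l l') (by omega) (by omega)
    have hmul : u l * u l' = u (max l l') := by
      rcases le_total l l' with h' | h'
      · rw [max_eq_right h', (habs l' (by omega) l h').1]
      · rw [max_eq_left h', (habs l (by omega) l' h').2]
    rw [← hmul, Ultrafilter.eventually_mul] at h
    simpa only [hm, forall_const, mul_assoc] using h
  · exact Eventually.of_forall fun y h => absurd h hm

/-- A product that has reached its target layer admits the factor `e` from layer `0`, which changes
nothing. -/
theorem Promising.word_prod (he : ∀ x : T, x * e = x) (hu : u 0 = pure e) {s : Stage T}
    (hs : s.Promising u) (h : s.current = s.target) :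
    (u s.target).IterEventually s.remaining fun t => s.word (s.prod :: t) := by
  have h0 := hs 0 (Nat.zero_le _) (by omega)
  rw [hu, Ultrafilter.coe_pure, eventually_pure] at h0
  simpa only [he] using h0

theorem promising_of_iterEventually (he : ∀ x : T, e * x = x) {n j : ℕ} {R : List T → Prop}
    (h : (u j).IterEventually (n + 1) R) : Promising u ⟨j, n, R, e, 0⟩ := by
  intro l hl hm
  obtain rfl : l = j := by simpa using hm
  simp only [he]
  exact h

theorem Promising.finish (he : ∀ x : T, e * x = x) (he' : ∀ x : T, x * e = x) (hu : u 0 = pure e)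
    {s : Stage T} (hs : s.Promising u) (h : s.current = s.target) (hr : s.remaining ≠ 0) :
    (s.finish e).Promising u := by
  have h0 := hs.word_prod he' hu h
  obtain ⟨n, hn⟩ := Nat.exists_eq_succ_of_ne_zero hr
  refine promising_of_iterEventually he ?_
  rwa [hn] at h0 ⊢

/-- The stages reached from stages in `C` by multiplying the product by the images of `b` under
the maps in the sets `G l`. -/
def mulSet (G : ℕ → Set (T → T)) (C : Set (Stage T)) (b : T) : Set (Stage T) :=
  ⋃ s ∈ C, ⋃ l ∈ Set.Iic s.target, (fun g => s.mulRight (g b) l) '' G l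

/-- The stages reached from stages in `C` by multiplying the product by the images of `b` under
the maps in the sets `G l`, and possibly finishing the product. -/
def stepSet (e : T) (G : ℕ → Set (T → T)) (C : Set (Stage T)) (b : T) : Set (Stage T) :=
  mulSet G C b ∪ finish e '' {s ∈ mulSet G C b | s.current = s.target ∧ s.remaining ≠ 0}

theorem mem_mulSet {G : ℕ → Set (T → T)} {C : Set (Stage T)} {b : T} {s : Stage T} :
    s ∈ mulSet G C b ↔ ∃ t ∈ C, ∃ l ≤ t.target, ∃ g ∈ G l, t.mulRight (g b) l = s := by
  simp [mulSet]

theorem finite_stepSet {G : ℕ → Set (T → T)} (hG : ∀ l ≤ k, (G l).Finite) {C : Set (Stage T)}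
    (hC : C.Finite) (hCk : ∀ s ∈ C, s.target ≤ k) (b : T) : (stepSet e G C b).Finite := by
  have : (mulSet G C b).Finite := hC.biUnion fun s hs =>
    (Set.finite_Iic _).biUnion fun l hl => (hG l (le_trans hl (hCk s hs))).image _
  exact this.union ((this.subset (Set.sep_subset _ _)).image _)

theorem eventually_promising_stepSet (he : ∀ x : T, e * x = x) (he' : ∀ x : T, x * e = x)
    (hu : u 0 = pure e) (habs : IsAbsorbing k u) {G : ℕ → Set (T → T)}
    (hG : ∀ l ≤ k, (G l).Finite) (hGu : ∀ l ≤ k, ∀ g ∈ G l, (u k).map g = u l)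
    {C : Set (Stage T)} (hC : C.Finite) (hCu : ∀ s ∈ C, s.target ≤ k ∧ s.Promising u) :
    ∀ᶠ b in u k, ∀ s ∈ stepSet e G C b, s.target ≤ k ∧ s.Promising u := by
  have : ∀ᶠ b in u k, ∀ s ∈ C, ∀ l ∈ Set.Iic s.target, ∀ g ∈ G l,
      (s.mulRight (g b) l).Promising u := by
    refine (eventually_all_finite hC).2 fun s hs =>
      (eventually_all_finite (Set.finite_Iic _)).2 fun l hl => ?_
    have hlk : l ≤ k := le_trans hl (hCu s hs).1
    refine (eventually_all_finite (hG l hlk)).2 fun g hg => ?_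
    have h := (hCu s hs).2.mulRight habs (hCu s hs).1 hl
    -- Since `g` pushes `u k` to `u l`, the condition on generic `y` for `u l` becomes one on `g b`
    -- for generic `b` for `u k`.
    rwa [← hGu l hlk g hg, Ultrafilter.coe_map, eventually_map] at h
  refine this.mono fun b hb => ?_
  have hmul : ∀ s ∈ mulSet G C b, s.target ≤ k ∧ s.Promising u := by
    intro s hs
    obtain ⟨t, ht, l, hl, g, hg, rfl⟩ := mem_mulSet.1 hs
    exact ⟨(hCu t ht).1, hb t ht l hl g hg⟩
  rintro s (hs | ⟨t, ⟨ht, htc, htr⟩, rfl⟩)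
  · exact hmul s hs
  · exact ⟨(hmul t ht).1, (hmul t ht).2.finish he he' hu htc htr⟩

/-- A sequence of elements such that all stages reached by multiplying and finishing,
starting with a given finite set of promising stages, are promising. -/
theorem exists_sequence (he : ∀ x : T, e * x = x) (he' : ∀ x : T, x * e = x)
    (hu : u 0 = pure e) (habs : IsAbsorbing k u) {G : ℕ → Set (T → T)}
    (hG : ∀ l ≤ k, (G l).Finite) (hGu : ∀ l ≤ k, ∀ g ∈ G l, (u k).map g = u l)
    {p : T → Prop} (hp : ∀ᶠ b in u k, p b)
    {C₀ : Set (Stage T)} (hC₀ : C₀.Finite) (hCu : ∀ s ∈ C₀, s.target ≤ k ∧ s.Promising u) :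
    ∃ (b : ℕ → T) (C : ℕ → Set (Stage T)), (∀ n, p (b n)) ∧ C 0 = C₀ ∧
      (∀ n, ∀ s ∈ C n, s.Promising u) ∧
      (∀ n, ∀ s ∈ C n, ∀ l ≤ s.target, ∀ g ∈ G l, s.mulRight (g (b n)) l ∈ C (n + 1)) ∧
      ∀ n, ∀ s ∈ C (n + 1), s.target ≠ 0 → s.current = s.target → s.remaining ≠ 0 →
        s.finish e ∈ C (n + 1) := by
  have hnext : ∀ C : {C : Set (Stage T) // C.Finite ∧ ∀ s ∈ C, s.target ≤ k ∧ s.Promising u},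
      ∃ b, p b ∧ ∀ s ∈ stepSet e G C.1 b, s.target ≤ k ∧ s.Promising u := fun C =>
    (hp.and (eventually_promising_stepSet he he' hu habs hG hGu C.2.1 C.2.2)).exists
  choose next hnext_p hnext using hnext
  let C : ℕ → {C : Set (Stage T) // C.Finite ∧ ∀ s ∈ C, s.target ≤ k ∧ s.Promising u} :=
    fun n => Nat.rec ⟨C₀, hC₀, hCu⟩ (fun _ D => ⟨stepSet e G D.1 (next D),
      finite_stepSet hG D.2.1 (fun s hs => (D.2.2 s hs).1) _, hnext D⟩) n
  refine ⟨fun n => next (C n), fun n => (C n).1, fun n => hnext_p _, rfl,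
    fun n s hs => ((C n).2.2 s hs).2, fun n s hs l hl g hg => ?_, fun n s hs h0 hc hr => ?_⟩
  · exact Or.inl (mem_mulSet.2 ⟨s, hs, l, hl, g, hg, rfl⟩)
  · rcases hs with hs | ⟨t, -, rfl⟩
    · exact Or.inr ⟨s, ⟨hs, hc, hr⟩, rfl⟩
    -- A freshly finished stage has current layer `0`, so it could be finished again only for target
    -- `0`.
    · exact absurd hc.symm h0

end Stage

/-! ### From stages to tetris subspaces -/

namespace PartialSemigroup

theorem IsProd.congr {S : Type*} [PartialSemigroup S] {x x' : ℕ → S} {p q : ℕ} {y : S}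
    (h : IsProd x p q y) (hx : ∀ i, p ≤ i → i < q → x i = x' i) : IsProd x' p q y := by
  induction h with
  | single => exact hx p le_rfl (Nat.lt_succ_self p) ▸ IsProd.single
  | @snoc q y z h hz ih =>
    have hpq : p < q := by
      clear ih hz hx
      induction h <;> omega
    refine IsProd.snoc (ih fun i hi hiq => hx i hi (by omega)) ?_
    rwa [← hx q hpq.le (Nat.lt_succ_self q)]

end PartialSemigroup

namespace TetrisAction

open PartialSemigroup WithUndef

variable {S : Type*} [PartialSemigroup S] {k : ℕ} {L : LayeredPartialSemigroup S k}
  {𝒜 : TetrisAction L}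

theorem IsBlockSeq.mem_blocks {j : ℕ} {b : ℕ → S} (hb : 𝒜.IsBlockSeq j b) (m : ℕ) :
    (fun i : Fin m => b i) ∈ 𝒜.blocks j m := by
  refine ⟨fun i => hb.1 i, fun n f x hn hf => ?_⟩
  obtain ⟨y, hy⟩ := hb.2 n f fun i hi => (hf ⟨i, by omega⟩ hi).1
  exact ⟨y, hy.congr fun i _ hi => ((hf ⟨i, by omega⟩ (Nat.lt_succ_iff.1 hi)).2).symm⟩

theorem exists_stage_of_isProd {b : ℕ → S} {C : ℕ → Set (Stage (WithUndef S))}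
    (hC : ∀ n, ∀ s ∈ C n, ∀ l ≤ s.target, ∀ g, 𝒜.G k l g →
      s.mulRight (of (g (b n))) l ∈ C (n + 1))
    {p q : ℕ} {f : ℕ → S → S} {l : ℕ → ℕ} {y : S}
    {s : Stage (WithUndef S)}
    (hs : s ∈ C p) (h : IsProd (fun i => f i (b i)) p q y)
    (hl : ∀ i ∈ Set.Ico p q, l i ≤ s.target ∧ 𝒜.G k (l i) (f i)) :
    p < q ∧ ∃ c, { s with prod := s.prod * of y, current := c } ∈ C q ∧
      (∀ i ∈ Set.Ico p q, l i ≤ c) ∧ (c = s.current ∨ ∃ i ∈ Set.Ico p q, c = l i) := by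
  induction h with
  | single =>
    obtain ⟨hl₁, hl₂⟩ := hl p ⟨le_rfl, Nat.lt_succ_self p⟩
    refine ⟨Nat.lt_succ_self p, _, hC p s hs _ hl₁ _ hl₂, fun i hi => ?_, ?_⟩
    · obtain rfl : i = p := Nat.le_antisymm (Nat.lt_succ_iff.1 hi.2) hi.1
      exact le_max_right _ _
    · exact (max_choice s.current (l p)).imp_right fun h => ⟨p, ⟨le_rfl, Nat.lt_succ_self p⟩, h⟩
  | @snoc q y z h hz ih =>
    obtain ⟨hpq, c, hc, hle, hor⟩ := ih fun i hi => hl i ⟨hi.1, by have := hi.2; omega⟩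
    obtain ⟨hl₁, hl₂⟩ := hl q ⟨hpq.le, Nat.lt_succ_self q⟩
    have hmem := hC q _ hc _ hl₁ _ hl₂
    refine ⟨by omega, max c (l q), ?_, fun i hi => ?_, ?_⟩
    · simpa only [Stage.mulRight, mul_assoc, of_mul_of_eq_of.2 hz] using hmem
    · rcases Nat.lt_succ_iff_lt_or_eq.1 hi.2 with h | rfl
      · exact le_max_of_le_left (hle i ⟨hi.1, h⟩)
      · exact le_max_right _ _
    · rcases max_choice c (l q) with h | h
      · rw [h]
        exact hor.imp_right fun ⟨i, hi, h⟩ => ⟨i, ⟨hi.1, by have := hi.2; omega⟩, h⟩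
      · exact Or.inr ⟨q, ⟨hpq.le, Nat.lt_succ_self q⟩, h⟩

/-- Each block has maximal layer `j`, so its product is at the target layer exactly when its cut
point arrives and may be finished there; the last block is closed by `word_prod`. -/
theorem word_of_stage {b : ℕ → S} {C : ℕ → Set (Stage (WithUndef S))}
    (hC : ∀ n, ∀ s ∈ C n, ∀ l ≤ s.target, ∀ g, 𝒜.G k l g →
      s.mulRight (of (g (b n))) l ∈ C (n + 1))
    {u : ℕ → Ultrafilter (WithUndef S)} {e : S} (he : IsIdentity e)
    (hu : u 0 = pure (of e)) (hprom : ∀ n, ∀ s ∈ C n, s.Promising u)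
    (hfin : ∀ n, ∀ s ∈ C (n + 1), s.target ≠ 0 → s.current = s.target → s.remaining ≠ 0 →
      s.finish (of e) ∈ C (n + 1))
    {j : ℕ} (hj : j ≠ 0) {l : ℕ → ℕ} {f : ℕ → S → S} {n : ℕ} {c : Fin (n + 2) → ℕ}
    {a : Fin (n + 1) → S} {R : List (WithUndef S) → Prop}
    (hs : ⟨j, n, R, of e, 0⟩ ∈ C (c 0))
    (hf : ∀ d : Fin (n + 1), ∀ i ∈ Set.Ico (c d.castSucc) (c d.succ), 𝒜.G k (l i) (f i))
    (hl : ∀ d : Fin (n + 1), IsGreatest (l '' Set.Ico (c d.castSucc) (c d.succ)) j)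
    (ha : ∀ d : Fin (n + 1), IsProd (fun i => f i (b i)) (c d.castSucc) (c d.succ) (a d)) :
    R (List.ofFn fun d => of (a d)) := by
  have first : ∀ {n : ℕ} {c : Fin (n + 2) → ℕ} {a : Fin (n + 1) → S}
      {R : List (WithUndef S) → Prop}, ⟨j, n, R, of e, 0⟩ ∈ C (c 0) →
      (∀ d : Fin (n + 1), ∀ i ∈ Set.Ico (c d.castSucc) (c d.succ), 𝒜.G k (l i) (f i)) →
      (∀ d : Fin (n + 1), IsGreatest (l '' Set.Ico (c d.castSucc) (c d.succ)) j) →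
      (∀ d : Fin (n + 1), IsProd (fun i => f i (b i)) (c d.castSucc) (c d.succ) (a d)) →
      c 0 < c 1 ∧ ⟨j, n, R, of (a 0), j⟩ ∈ C (c 1) := by
    intro n c a R hs hf hl ha
    obtain ⟨hlt, t, ht, hle, hor⟩ := exists_stage_of_isProd hC hs (ha 0) fun i hi =>
      ⟨(hl 0).2 ⟨i, hi, rfl⟩, hf 0 i hi⟩
    refine ⟨hlt, ?_⟩
    obtain ⟨i, hi, hij⟩ := (hl 0).1
    obtain rfl : t = j := by
      have h₁ := hle i hi
      rcases hor with h | ⟨i', hi', h⟩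
      · simp only at h
        omega
      · have h₂ := (hl 0).2 ⟨i', hi', rfl⟩
        omega
    simp only [of_identity_mul he] at ht
    exact ht
  induction n generalizing R with
  | zero =>
    obtain ⟨-, h⟩ := first hs hf hl ha
    exact (hprom _ _ h).word_prod (of_mul_of_identity he) hu rfl
  | succ n ih =>
    obtain ⟨hlt, h⟩ := first hs hf hl ha
    -- Closure under finishing is available only for sets `C (q + 1)`.
    obtain ⟨q, hq⟩ := Nat.exists_eq_succ_of_ne_zero (Nat.ne_zero_of_lt hlt)
    have h' : (⟨j, n, fun t => R (of (a 0) :: t), of e, 0⟩ : Stage (WithUndef S)) ∈ C (c 1) := by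
      rw [hq] at h ⊢
      exact hfin q _ h hj rfl (Nat.succ_ne_zero n)
    rw [List.ofFn_succ]
    exact ih (c := fun d => c d.succ) (a := fun d => a d.succ)
      (R := fun t => R (of (a 0) :: t)) h' (fun d => hf d.succ) (fun d => hl d.succ)
      (fun d => ha d.succ)

/-- Starting at current layer `k` makes factors from all layers admissible and keeps the product at
its target, so the word condition, which excludes `undef`, can be read off after every factor. -/
theorem exists_isProd_of_stage {b : ℕ → S} {C : ℕ → Set (Stage (WithUndef S))}
    (hC : ∀ n, ∀ s ∈ C n, ∀ l ≤ s.target, ∀ g, 𝒜.G k l g →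
      s.mulRight (of (g (b n))) l ∈ C (n + 1))
    {u : ℕ → Ultrafilter (WithUndef S)} {e : S} (he : IsIdentity e)
    (hu : u 0 = pure (of e)) (hprom : ∀ n, ∀ s ∈ C n, s.Promising u)
    (hs : ⟨k, 0, fun t => ∃ z, t = [of z], of e, k⟩ ∈ C 0) {n : ℕ} {f : ℕ → S → S}
    (hf : ∀ i ≤ n, ∃ l ≤ k, 𝒜.G k l (f i)) :
    ∃ y, IsProd (fun i => f i (b i)) 0 (n + 1) y ∧
      ⟨k, 0, fun t => ∃ z, t = [of z], of y, k⟩ ∈ C (n + 1) := by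
  have step : ∀ {n : ℕ} {x : S}, ⟨k, 0, fun t => ∃ z, t = [of z], of x, k⟩ ∈ C n →
      (∃ l ≤ k, 𝒜.G k l (f n)) → ∃ y, op x (f n (b n)) = some y ∧
        ⟨k, 0, fun t => ∃ z, t = [of z], of y, k⟩ ∈ C (n + 1) := by
    rintro n x hx ⟨l, hl, hg⟩
    have hmem := hC n _ hx l hl _ hg
    simp only [Stage.mulRight, max_eq_left hl] at hmem
    obtain ⟨y, hy⟩ := (hprom _ _ hmem).word_prod (of_mul_of_identity he) hu rfl
    rw [List.cons.injEq, and_iff_left rfl] at hy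
    exact ⟨y, of_mul_of_eq_of.1 hy, hy ▸ hmem⟩
  induction n with
  | zero =>
    obtain ⟨y, hy, hmem⟩ := step hs (hf 0 le_rfl)
    rw [(he _).1, Option.some_inj] at hy
    exact ⟨y, hy ▸ IsProd.single, hmem⟩
  | succ n ih =>
    obtain ⟨x, hx, hxmem⟩ := ih fun i hi => hf i (by omega)
    obtain ⟨y, hy, hmem⟩ := step hxmem (hf (n + 1) le_rfl)
    exact ⟨y, hx.snoc hy, hmem⟩

theorem exists_monochromatic_tetrisSubspace {ι : Type*} [Finite ι] [Nonempty ι]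
    (𝒜 : TetrisAction L) (n : ℕ) (χ : 𝒜.blocksUpTo k (n + 1) → ι) :
    ∃ b : ℕ → S, 𝒜.IsBlockSeq k b ∧
      (∀ (n : ℕ) (f : ℕ → S → S), (∀ i ≤ n, ∃ l, l ≤ k ∧ 𝒜.G k l (f i)) →
        ∃ y, IsProd (fun i => f i (b i)) 0 (n + 1) y) ∧
      ∀ j, 1 ≤ j → j ≤ k → ∃ color : ι, ∀ a : 𝒜.blocksUpTo k (n + 1),
        a.1 ∈ 𝒜.tetrisSubspace j (n + 1) b → χ a = color := by
  obtain ⟨u, hcomp, habs⟩ := 𝒜.exists_compatible_isAbsorbing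
  obtain ⟨e, he, h0⟩ := L.layer_zero
  have hu : u 0 = pure (of e) := by
    have h := hcomp.1 0 (Nat.zero_le k)
    change u 0 ∈ cofiniteUltrafilters (L.layer 0) at h
    rwa [L.cofiniteUltrafilters_layer_zero he h0] at h
  have hmem : ∀ l ≤ k, u l ∈ cofiniteUltrafilters (L.layer l) := hcomp.1
  -- A list that does not come from a block sequence satisfies `R c` for every colour `c`, so the
  -- ultrafilters need not be shown to produce block sequences.
  let R : ι → List (WithUndef S) → Prop := fun c t =>
    ∀ a : 𝒜.blocksUpTo k (n + 1), List.ofFn (fun d => of (a.1 d)) = t → χ a = c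
  have hR : ∀ t, ∃ c, R c t := by
    intro t
    by_cases h : ∃ a : 𝒜.blocksUpTo k (n + 1), List.ofFn (fun d => of (a.1 d)) = t
    · obtain ⟨a, rfl⟩ := h
      refine ⟨χ a, fun a' ha' => congrArg χ (Subtype.ext (funext fun d => ?_))⟩
      exact Option.some.inj (congrFun (List.ofFn_injective ha') d)
    · exact ⟨Classical.arbitrary ι, fun a ha => absurd ⟨a, ha⟩ h⟩
  choose color hcolor using fun j => (u j).exists_iterEventually (n + 1) R hR
  obtain ⟨b', C, hb', hC0, hprom, hmul, hfin⟩ := Stage.exists_sequence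
    (of_identity_mul he) (of_mul_of_identity he) hu habs
    (G := fun l => WithUndef.map '' {g | 𝒜.G k l g}) (fun l hl => (𝒜.finite_setOf_G hl).image _)
    (by
      rintro l - _ ⟨g, hg, rfl⟩
      exact 𝒜.map_G hcomp hg)
    (hmem k le_rfl).1
    -- One stage guards definedness of products and one for each `j` guards the colour. The element
    -- under construction is not counted as remaining, hence `n` for words of length `n + 1`.
    (C₀ := insert ⟨k, 0, fun t => ∃ z, t = [of z], of e, k⟩
      ((fun j => ⟨j, n, R (color j), of e, 0⟩) '' Set.Iic k))
    (((Set.finite_Iic k).image _).insert _) (by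
      rintro s (rfl | ⟨j, hj, rfl⟩)
      · refine ⟨le_rfl, fun l hl _ => ?_⟩
        refine (hmem l hl).1.mono fun y ⟨a, _, hy⟩ => ⟨a, ?_⟩
        simp only [of_identity_mul he, hy]
      · exact ⟨hj, Stage.promising_of_iterEventually (of_identity_mul he) (hcolor j)⟩)
  choose b hb hbb' using hb'
  have hC : ∀ n, ∀ s ∈ C n, ∀ l ≤ s.target, ∀ g, 𝒜.G k l g →
      s.mulRight (of (g (b n))) l ∈ C (n + 1) := by
    intro n s hs l hl g hg
    have h := hmul n s hs l hl _ ⟨g, hg, rfl⟩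
    rwa [hbb', map_of] at h
  have hdef : ∀ (n : ℕ) (f : ℕ → S → S), (∀ i ≤ n, ∃ l, l ≤ k ∧ 𝒜.G k l (f i)) →
      ∃ y, IsProd (fun i => f i (b i)) 0 (n + 1) y := fun n f hf =>
    (exists_isProd_of_stage hC he hu hprom (hC0 ▸ Set.mem_insert _ _) hf).imp fun _ h => h.1
  refine ⟨b, ⟨hb, fun n f hf => hdef n f fun i hi => ?_⟩, hdef, fun j hj hjk => ⟨color j, ?_⟩⟩
  · obtain ⟨l, -, hl⟩ := hf i hi
    exact ⟨l, hl⟩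
  · rintro a ⟨-, c, l, f, hc0, hc, hf, ha⟩
    refine word_of_stage (a := a.1) (c := c) (l := l) (f := f) hC he hu hprom hfin (j := j)
      (by omega) (R := R (color j)) ?_ (fun d i hi => (hf i ?_).2) (fun d => (ha d).1)
      (fun d => (ha d).2) a rfl
    · rw [hc0, hC0]
      exact Set.mem_insert_of_mem _ ⟨j, hjk, rfl⟩
    · exact lt_of_lt_of_le hi.2 (hc.monotone (Fin.le_last _))

end TetrisAction

end Proof

theorem theorem4p5 {S : Type*} [PartialSemigroup S] {k : ℕ}
    (L : LayeredPartialSemigroup S k) (𝒜 : TetrisAction L)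
    (m : ℕ) (hm : 1 ≤ m) (r : ℕ) (χ : 𝒜.blocksUpTo k m → Fin r) :
    ∃ b : ℕ → S, 𝒜.IsBlockSeq k b ∧
      -- all products used to form tetris subspaces, also those with factors in layer `0`,
      -- are defined
      (∀ (n : ℕ) (f : ℕ → S → S), (∀ i ≤ n, ∃ l, l ≤ k ∧ 𝒜.G k l (f i)) →
        ∃ y, PartialSemigroup.IsProd (fun i => f i (b i)) 0 (n + 1) y) ∧
      ∀ j, 1 ≤ j → j ≤ k →
        ∃ color : Fin r, ∀ a : 𝒜.blocksUpTo k m, a.1 ∈ 𝒜.tetrisSubspace j m b → χ a = color := by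
  obtain ⟨n, rfl⟩ := Nat.exists_eq_add_of_le' hm
  rcases isEmpty_or_nonempty (Fin r) with hr | hr
  -- With no colours, the sequence comes from a one-point colouring; its initial segment would need
  -- a colour under `χ` as soon as some `j` with `1 ≤ j ≤ k` exists.
  · obtain ⟨b, hb, hdef, -⟩ := 𝒜.exists_monochromatic_tetrisSubspace n fun _ => ()
    exact ⟨b, hb, hdef, fun j hj hjk =>
      hr.elim (χ ⟨_, k, hj.trans hjk, le_rfl, hb.mem_blocks (n + 1)⟩)⟩
  · exact 𝒜.exists_monochromatic_tetrisSubspace n χ
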